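/- All graphs are finite, simple and undirected, and a graph is non-trivial if it has at least two vertices; $\delta$ denotes the minimum degree. For a graph $F$ and a set $S\subseteq V(F)$ with $|S|\ge 2$, an $S$-tree is a subgraph $T$ of $F$ that is a tree with $S\subseteq V(T)$, and $\lambda(S)$ is the maximum number of pairwise edge-disjoint $S$-trees in $F$. For a graph $F$ with at least three vertices, the generalized 3-edge-connectivity of $F$ is $\lambda_3(F)=\min\{\lambda(S) : S\subseteq V(F),\ |S|=3\}$ (which is $0$ if $F$ is disconnected). The lexicographic product $G\circ H$ has vertex set $V(G)\times V(H)$, and $(u,v)$, $(u',v')$ are adjacent if and only if either $uu'\in E(G)$, or $u=u'$ and $vv'\in E(H)$. Theorem. Let $G$ and $H$ be non-trivial graphs with $G$ connected. If $|V(G)|\ge 3$, then $$\lambda_3(G\circ H)\le\min\left\{\left\lfloor\frac{4\lambda_3(G)+2}{3}\right\rfloor |V(H)|^2,\ \delta(H)+\delta(G)\,|V(H)|\right\}.$$ If $|V(G)|=2$ (so that $\lambda_3(G)$ is not defined), then $\lambda_3(G\circ H)\le\delta(H)+\delta(G)\,|V(H)|$. Moreover, the upper bound is sharp: for every $N$ there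 are non-trivial graphs $G$ and $H$, with $G$ connected, $|V(G)|\ge 3$ and $|V(G)|,|V(H)|\ge N$, for which equality holds in the displayed inequality. -/

import Mathlib

namespace SimpleGraph

/-- The lexicographic product: `(u, v)` and `(u', v')` are adjacent iff either `u` is adjacent
to `u'` in `G`, or `u = u'` and `v` is adjacent to `v'` in `H`. -/
def lexProduct {V W : Type*} (G : SimpleGraph V) (H : SimpleGraph W) : SimpleGraph (V × W) where
  Adj p q := G.Adj p.1 q.1 ∨ (p.1 = q.1 ∧ H.Adj p.2 q.2)
  symm := ⟨fun _ _ h => h.elim (fun h => Or.inl h.symm) (fun h => Or.inr ⟨h.1.symm, h.2.symm⟩)⟩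
  loopless := ⟨fun _ h => h.elim (fun h => h.ne rfl) (fun h => h.2.ne rfl)⟩

/-- An `S`-Steiner tree of `G`: a subgraph of `G` that is a tree and contains all vertices
of `S`. -/
def IsSteinerTree {V : Type*} (G : SimpleGraph V) (S : Finset V) (T : G.Subgraph) : Prop :=
  T.coe.IsTree ∧ (S : Set V) ⊆ T.verts

/-- `λ(S)`: the maximum number of pairwise edge-disjoint `S`-Steiner trees of `G`.
(For finite `V` and `S` of at least two vertices every Steiner tree has an edge,
so the set is bounded and the supremum is a maximum.) -/
noncomputable def steinerPacking {V : Type*} (G : SimpleGraph V) (S : Finset V) : ℕ :=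
  sSup {m : ℕ | ∃ T : Fin m → G.Subgraph, (∀ i, G.IsSteinerTree S (T i)) ∧
    ∀ i j, i ≠ j → Disjoint (T i).edgeSet (T j).edgeSet}

/-- The generalized `k`-edge-connectivity `λ_k(G)`: the minimum of `λ(S)` over all `k`-element
sets `S` of vertices. It is meant for `2 ≤ k ≤ |V|`. In that range its value is `0` for
disconnected `G`, since some `S` then meets two components. -/
noncomputable def genEdgeConn {V : Type*} (k : ℕ) (G : SimpleGraph V) : ℕ :=
  sInf {m : ℕ | ∃ S : Finset V, S.card = k ∧ G.steinerPacking S = m}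

end SimpleGraph

/-!
The bound by the minimum degree holds because the Steiner trees of any three vertices, one of which
has minimum degree, use different edges at that vertex.

For the other bound, let `S` attain `λ₃(G)` and let `X` be a smallest cut of `G` separating `S`,
with `k` edges. The preimage of `X` is a cut of `G ∘ H` with at most `k * |W| ^ 2` edges, and each
Steiner tree of three vertices on both sides uses one of them, so `λ₃(G ∘ H) ≤ k * |W| ^ 2`. It
remains to see that `3 * k ≤ 4 * λ₃(G) + 2`. This is Kriesell's theorem on three terminals,
`Multigraph.exists_hasConnectors`: if all cuts separating the terminals have at least `k` edges,
there are `n` disjoint connected edge sets containing the terminals, with `3 * k ≤ 4 * n + 2`.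

Kriesell's theorem is proved for multigraphs, by induction on the number of edges. An edge that can
be deleted without creating a cut smaller than `k` is deleted. Otherwise every edge lies in a cut of
size `k`, one side `X` of which contains a single terminal. If some edge lies inside `X`, then `X`
is contracted to its terminal, and the connectors found in the smaller graph are prolonged within
`X` by Menger's theorem (`Multigraph.exists_isLinkage`, proved by the same kind of contraction). If
this never applies, every edge is incident to a terminal of degree `k`. Then at each other vertex
the numbers of edges to the three terminals satisfy the triangle inequalities, so all edges
decompose into paths between two terminals and tripods joining all three
(`Multigraph.decomposes_of_star`). Each tripod is a connector, each pair of paths of different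
kinds is another one, and counting pieces at the terminals gives the bound
(`Multigraph.HasPieces.hasConnectors`).

Equality holds for a star `G` and an edgeless graph `H`: in `G ∘ H` each of the `|W|` copies `c` of
the centre has a private leaf `x`, and a Steiner tree is formed by joining `c` to `x` and to the
terminals that are leaves, and `x` to the terminals that are centres.
-/

/-! ### Cuts and connectors in multigraphs -/

namespace Multigraph

open scoped Classical

variable {V E : Type*}

/-- The edges of `F` with exactly one end in `X`. A multigraph is given by a set of edges and the
two maps `s`, `t` sending an edge to its ends; the order of the two ends is irrelevant. -/
noncomputable def cut (s t : E → V) (F : Finset E) (X : Set V) : Finset E :=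
  F.filter fun e => ¬(s e ∈ X ↔ t e ∈ X)

/-- The edges of `F` with both ends in `X`. -/
noncomputable def inside (s t : E → V) (F : Finset E) (X : Set V) : Finset E :=
  F.filter fun e => s e ∈ X ∧ t e ∈ X

/-- `u` and `v` lie in the same component of the edge set `J`, stated by duality: no vertex set
that is left by no edge of `J` separates them. -/
def Joined (s t : E → V) (J : Finset E) (u v : V) : Prop :=
  ∀ X : Set V, (∀ e ∈ J, (s e ∈ X ↔ t e ∈ X)) → (u ∈ X ↔ v ∈ X)

/-- The map contracting the vertex set `Y` to the vertex `a`. -/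
noncomputable def collapse (Y : Set V) (a v : V) : V := if v ∈ Y then a else v

variable {s t : E → V} {F J K : Finset E} {X Y : Set V} {a u v w : V} {e : E}

lemma mem_cut : e ∈ cut s t F X ↔ e ∈ F ∧ ¬(s e ∈ X ↔ t e ∈ X) := by simp [cut]

lemma mem_inside : e ∈ inside s t F X ↔ e ∈ F ∧ s e ∈ X ∧ t e ∈ X := by simp [inside]

lemma cut_erase : cut s t (F.erase e) X = (cut s t F X).erase e := by
  ext f; simp only [mem_cut, Finset.mem_erase]; tauto

lemma card_cut_le_card_cut_erase_add_one :
    (cut s t F X).card ≤ (cut s t (F.erase e) X).card + 1 := by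
  rw [cut_erase]; have := Finset.pred_card_le_card_erase (s := cut s t F X) (a := e); omega

lemma mem_cut_of_card_cut_erase_lt (h : (cut s t (F.erase e) X).card < (cut s t F X).card) :
    e ∈ cut s t F X := by
  by_contra he
  rw [cut_erase, Finset.erase_eq_of_notMem he] at h
  exact lt_irrefl _ h

lemma Joined.refl : Joined s t J u u := fun _ _ => Iff.rfl

lemma Joined.symm (h : Joined s t J u v) : Joined s t J v u := fun X hX => (h X hX).symm

lemma Joined.trans (h : Joined s t J u v) (h' : Joined s t J v w) : Joined s t J u w :=
  fun X hX => (h X hX).trans (h' X hX)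

lemma Joined.mono (h : Joined s t J u v) (hJK : J ⊆ K) : Joined s t K u v :=
  fun X hX => h X fun e he => hX e (hJK he)

lemma Joined.of_mem (h : e ∈ J) : Joined s t J (s e) (t e) := fun _ hX => hX e h

lemma Joined.of_mem_of_sym2_eq (h : e ∈ J) (he : s(s e, t e) = s(u, v)) : Joined s t J u v := by
  rcases Sym2.eq_iff.1 he with ⟨rfl, rfl⟩ | ⟨rfl, rfl⟩
  · exact .of_mem h
  · exact (Joined.of_mem h).symm

/-- A connection in the graph with `Y` contracted to `a` lifts to any edge set that moreover joins
`a` to every vertex of `Y` through which the connection passes. -/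
lemma Joined.of_collapse (h : Joined (fun e => collapse Y a (s e)) (fun e => collapse Y a (t e)) J
      (collapse Y a u) (collapse Y a v)) (hJK : J ⊆ K)
    (hs : ∀ e ∈ J, s e ∈ Y → Joined s t K a (s e)) (ht : ∀ e ∈ J, t e ∈ Y → Joined s t K a (t e))
    (hu : u ∈ Y → Joined s t K a u) (hv : v ∈ Y → Joined s t K a v) : Joined s t K u v := by
  intro Z hZ
  have key : ∀ x, (x ∈ Y → Joined s t K a x) → (collapse Y a x ∈ Z ↔ x ∈ Z) := by
    intro x hx
    unfold collapse
    split_ifs with hxY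
    · exact hx hxY Z hZ
    · exact Iff.rfl
  rw [← key u hu, ← key v hv]
  refine h Z fun e he => ?_
  rw [key _ (hs e he), key _ (ht e he)]
  exact hZ e (hJK he)

lemma collapse_of_mem (h : v ∈ Y) : collapse Y a v = a := if_pos h

lemma collapse_of_notMem (h : v ∉ Y) : collapse Y a v = v := if_neg h

lemma cut_collapse (Z : Set V) :
    cut (fun e => collapse Y a (s e)) (fun e => collapse Y a (t e)) (F \ inside s t F Y) Z =
      cut s t F {v | collapse Y a v ∈ Z} := by
  ext e
  simp only [mem_cut, Finset.mem_sdiff, mem_inside, Set.mem_ofPred_eq]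
  by_cases h1 : s e ∈ Y <;> by_cases h2 : t e ∈ Y <;> simp [collapse, h1, h2]

lemma collapse_mem_iff (hYX : Y ⊆ X) (ha : a ∈ X) : collapse Y a v ∈ X ↔ v ∈ X := by
  unfold collapse; split_ifs with h
  · exact iff_of_true ha (hYX h)
  · exact Iff.rfl

lemma exists_injOn_of_card_le {A B : Finset E} (h : A.card ≤ B.card) :
    ∃ f : E → E, (∀ e ∈ A, f e ∈ B) ∧ Set.InjOn f A := by
  obtain ⟨g⟩ : Nonempty (A ↪ B) := Function.Embedding.nonempty_of_card_le (by simpa using h)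
  refine ⟨fun e => if he : e ∈ A then (g ⟨e, he⟩ : E) else e, fun e he => by simp [he], ?_⟩
  intro e he e' he' hee
  have he : e ∈ A := he
  have he' : e' ∈ A := he'
  simp only [he, he', dite_true] at hee
  simpa using g.injective (Subtype.ext hee)

/-- The edge sets `P e` for those `e ∈ J` that leave `Y`. When `J` comes from the graph with `Y`
contracted, they continue `J` inside `Y`. -/
noncomputable def continuation (s t : E → V) (F : Finset E) (Y : Set V) (P : E → Finset E)
    (J : Finset E) : Finset E :=
  (J ∩ cut s t F Y).biUnion P

/-- `P` links `a` to the cut of `X`: the edge sets `P e` for `e` in the cut are disjoint, lie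
inside `X`, and `P e` joins `a` to the end of `e` in `X`. -/
structure IsLinkage (s t : E → V) (F : Finset E) (X : Set V) (a : V) (P : E → Finset E) :
    Prop where
  subset : ∀ e ∈ cut s t F X, P e ⊆ inside s t F X
  joined : ∀ e ∈ cut s t F X, (s e ∈ X → Joined s t (P e) a (s e)) ∧
    (t e ∈ X → Joined s t (P e) a (t e))
  disjoint : ∀ e ∈ cut s t F X, ∀ e' ∈ cut s t F X, e ≠ e' → Disjoint (P e) (P e')

namespace IsLinkage

variable {P : E → Finset E}

lemma continuation_subset (hP : IsLinkage s t F Y a P) :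
    continuation s t F Y P J ⊆ inside s t F Y :=
  Finset.biUnion_subset.2 fun e he => hP.subset e (Finset.mem_inter.1 he).2

lemma disjoint_union_continuation (hP : IsLinkage s t F Y a P)
    (hJ : Disjoint J (inside s t F Y)) (hK : Disjoint K (inside s t F Y)) (hJK : Disjoint J K) :
    Disjoint (J ∪ continuation s t F Y P J) (K ∪ continuation s t F Y P K) := by
  rw [Finset.disjoint_union_left, Finset.disjoint_union_right, Finset.disjoint_union_right]
  refine ⟨⟨hJK, hJ.mono_right hP.continuation_subset⟩,
    (hK.mono_right hP.continuation_subset).symm, ?_⟩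
  unfold continuation
  rw [Finset.disjoint_biUnion_left]
  intro e he
  rw [Finset.disjoint_biUnion_right]
  intro e' he'
  rw [Finset.mem_inter] at he he'
  exact hP.disjoint e he.2 e' he'.2 fun h => Finset.disjoint_left.1 hJK he.1 (h ▸ he'.1)

lemma joined_continuation (hP : IsLinkage s t F Y a P) (he : e ∈ J) (heF : e ∈ F)
    (hn : ¬(s e ∈ Y ∧ t e ∈ Y)) :
    (s e ∈ Y → Joined s t (continuation s t F Y P J) a (s e)) ∧
      (t e ∈ Y → Joined s t (continuation s t F Y P J) a (t e)) := by
  have hsub : e ∈ cut s t F Y → P e ⊆ continuation s t F Y P J := fun hc =>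
    Finset.subset_biUnion_of_mem P (Finset.mem_inter.2 ⟨he, hc⟩)
  refine ⟨fun h => ?_, fun h => ?_⟩
  · have hc : e ∈ cut s t F Y := mem_cut.2 ⟨heF, by tauto⟩
    exact ((hP.joined e hc).1 h).mono (hsub hc)
  · have hc : e ∈ cut s t F Y := mem_cut.2 ⟨heF, by tauto⟩
    exact ((hP.joined e hc).2 h).mono (hsub hc)

/-- A connection in the graph with `Y` contracted, completed by a linkage of `Y`. -/
lemma joined_union (hP : IsLinkage s t F Y a P) (hJF : J ⊆ F \ inside s t F Y) (hJK : J ⊆ K)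
    (h : Joined (fun e => collapse Y a (s e)) (fun e => collapse Y a (t e)) J
      (collapse Y a u) (collapse Y a v))
    (hu : u ∈ Y → Joined s t (continuation s t F Y P K) a u)
    (hv : v ∈ Y → Joined s t (continuation s t F Y P K) a v) :
    Joined s t (J ∪ continuation s t F Y P K) u v := by
  have key : ∀ e ∈ J, _ := fun e he => by
    have hm := Finset.mem_sdiff.1 (hJF he)
    exact hP.joined_continuation (hJK he) hm.1 fun hn => hm.2 (mem_inside.2 ⟨hm.1, hn⟩)
  exact h.of_collapse Finset.subset_union_left
    (fun e he hY => ((key e he).1 hY).mono Finset.subset_union_right)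
    (fun e he hY => ((key e he).2 hY).mono Finset.subset_union_right)
    (fun hY => (hu hY).mono Finset.subset_union_right)
    (fun hY => (hv hY).mono Finset.subset_union_right)

/-- Linkages compose: a linkage of `Y` prolongs a linkage of `X ⊇ Y` in the graph in which `Y` is
contracted. -/
lemma comp {Q : E → Finset E} (hYX : Y ⊆ X) (haY : a ∈ Y) (hP : IsLinkage s t F Y a P)
    (hQ : IsLinkage (fun e => collapse Y a (s e)) (fun e => collapse Y a (t e))
      (F \ inside s t F Y) X a Q) :
    IsLinkage s t F X a fun e => Q e ∪ continuation s t F Y P (insert e (Q e)) := by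
  have haX := hYX haY
  have hcut : cut (fun e => collapse Y a (s e)) (fun e => collapse Y a (t e))
      (F \ inside s t F Y) X = cut s t F X := by
    rw [cut_collapse]
    simp only [collapse_mem_iff hYX haX, Set.ofPred_mem_eq]
  have hins : ∀ e ∈ cut s t F X, Q e ⊆ inside s t F X \ inside s t F Y := fun e he f hf => by
    have := hQ.subset e (hcut ▸ he) hf
    simp only [mem_inside, Finset.mem_sdiff, collapse_mem_iff hYX haX] at this ⊢
    tauto
  have hXY : inside s t F Y ⊆ inside s t F X := fun e he => by
    rw [mem_inside] at he ⊢
    exact ⟨he.1, hYX he.2.1, hYX he.2.2⟩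
  have hcutY : ∀ e ∈ cut s t F X, ¬(s e ∈ Y ∧ t e ∈ Y) := fun e he h =>
    (mem_cut.1 he).2 (iff_of_true (hYX h.1) (hYX h.2))
  have hQF : ∀ e ∈ cut s t F X, Q e ⊆ F \ inside s t F Y := fun e he =>
    (hins e he).trans (Finset.sdiff_subset_sdiff (Finset.filter_subset _ _) le_rfl)
  refine ⟨fun e he => ?_, fun e he => ?_, fun e he e' he' hne => ?_⟩
  · exact Finset.union_subset ((hins e he).trans Finset.sdiff_subset)
      (hP.continuation_subset.trans hXY)
  · have hend := hP.joined_continuation (Finset.mem_insert_self e (Q e)) (mem_cut.1 he).1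
      (hcutY e he)
    have hj := hQ.joined e (hcut ▸ he)
    simp only [collapse_mem_iff hYX haX] at hj
    have ha : a ∈ Y → Joined s t (continuation s t F Y P (insert e (Q e))) a a :=
      fun _ => .refl
    refine ⟨fun h => ?_, fun h => ?_⟩
    · refine hP.joined_union (hQF e he) (Finset.subset_insert _ _) ?_ ha hend.1
      rw [collapse_of_mem haY]
      exact hj.1 h
    · refine hP.joined_union (hQF e he) (Finset.subset_insert _ _) ?_ ha hend.2
      rw [collapse_of_mem haY]
      exact hj.2 h
  · have hdis : ∀ e ∈ cut s t F X, Disjoint (insert e (Q e)) (inside s t F Y) := fun e he => by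
      rw [Finset.disjoint_insert_left]
      exact ⟨fun h => hcutY e he (mem_inside.1 h).2,
        Finset.disjoint_of_subset_left (hins e he) Finset.sdiff_disjoint⟩
    have hnot : ∀ e ∈ cut s t F X, ∀ e' ∈ cut s t F X, e ∉ Q e' := fun e he e' he' h => by
      have := mem_inside.1 (Finset.mem_sdiff.1 (hins e' he' h)).1
      exact (mem_cut.1 he).2 (iff_of_true this.2.1 this.2.2)
    have hins' : Disjoint (insert e (Q e)) (insert e' (Q e')) := by
      rw [Finset.disjoint_insert_left, Finset.disjoint_insert_right, Finset.mem_insert, not_or]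
      exact ⟨⟨hne, hnot e he e' he'⟩, hnot e' he' e he,
        hQ.disjoint e (hcut ▸ he) e' (hcut ▸ he') hne⟩
    exact (hP.disjoint_union_continuation (hdis e he) (hdis e' he') hins').mono
      (Finset.union_subset_union (Finset.subset_insert _ _) le_rfl)
      (Finset.union_subset_union (Finset.subset_insert _ _) le_rfl)

end IsLinkage

/-- If no set between `{a}` and `X` has a smaller cut than `X`, and all edges inside `X` are
incident to `a`, then at each vertex the edges to `a` are numerous enough to be matched with the
edges leaving `X`. -/
lemma exists_isLinkage_of_star (ha : a ∈ X)
    (hmin : ∀ Y ⊆ X, a ∈ Y → (cut s t F X).card ≤ (cut s t F Y).card)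
    (hstar : ∀ e ∈ inside s t F X, s e = a ∨ t e = a) : ∃ P, IsLinkage s t F X a P := by
  let A : V → Finset E := fun v => (inside s t F X).filter fun e => s e = v ∨ t e = v
  let B : V → Finset E := fun v => (cut s t F X).filter fun e => s e = v ∨ t e = v
  have hcard : ∀ v ∈ X, v ≠ a → (B v).card ≤ (A v).card := fun v hv hva => by
    have h1 := hmin (X \ {v}) Set.sdiff_subset ⟨ha, fun h => hva h.symm⟩
    have h2 : cut s t F (X \ {v}) ⊆ (cut s t F X \ B v) ∪ A v := fun e he => by
      simp only [mem_cut, A, B, Finset.mem_union, Finset.mem_sdiff, Finset.mem_filter, mem_inside,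
        Set.mem_sdiff, Set.mem_singleton_iff] at he ⊢
      grind
    have h3 := (Finset.card_le_card h2).trans (Finset.card_union_le _ _)
    have h4 : B v ⊆ cut s t F X := Finset.filter_subset _ _
    rw [Finset.card_sdiff_of_subset h4] at h3
    have h5 := Finset.card_le_card h4
    omega
  have hf : ∀ v, ∃ f : E → E, v ∈ X ∧ v ≠ a → (∀ e ∈ B v, f e ∈ A v) ∧ Set.InjOn f (B v) :=
    fun v => by
      by_cases hv : v ∈ X ∧ v ≠ a
      · obtain ⟨f, hf⟩ := exists_injOn_of_card_le (hcard v hv.1 hv.2)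
        exact ⟨f, fun _ => hf⟩
      · exact ⟨id, fun h => absurd h hv⟩
  choose f hf using hf
  let x : E → V := fun e => if s e ∈ X then s e else t e
  have hx : ∀ e ∈ cut s t F X, x e ∈ X ∧ e ∈ B (x e) ∧ (s e ∈ X → s e = x e) ∧
      (t e ∈ X → t e = x e) := fun e he => by
    have hc := (mem_cut.1 he).2
    by_cases h : s e ∈ X
    · simp [x, B, h, he]; tauto
    · have : t e ∈ X := by tauto
      simp [x, B, h, he, this]
  have hmem : ∀ e ∈ cut s t F X, x e ≠ a → f (x e) e ∈ inside s t F X ∧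
      s(s (f (x e) e), t (f (x e) e)) = s(a, x e) := fun e he hne => by
    have h := Finset.mem_filter.1 ((hf (x e) ⟨(hx e he).1, hne⟩).1 e (hx e he).2.1)
    refine ⟨h.1, Sym2.eq_iff.2 ?_⟩
    have := hstar _ h.1
    grind
  have hj : ∀ e ∈ cut s t F X, Joined s t (if x e = a then ∅ else {f (x e) e}) a (x e) :=
    fun e he => by
      split_ifs with h
      · rw [h]; exact .refl
      · exact .of_mem_of_sym2_eq (Finset.mem_singleton_self _) (hmem e he h).2
  refine ⟨fun e => if x e = a then ∅ else {f (x e) e}, fun e he => ?_, fun e he => ⟨fun h => ?_,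
    fun h => ?_⟩, fun e he e' he' hne => ?_⟩
  · split_ifs with h
    · simp
    · simpa using (hmem e he h).1
  · rw [(hx e he).2.2.1 h]; exact hj e he
  · rw [(hx e he).2.2.2 h]; exact hj e he
  · split_ifs with h h' h'
    · simp
    · simp
    · simp
    · rw [Finset.disjoint_singleton]
      intro hff
      have h1 := (hmem e he h).2
      rw [hff, (hmem e' he' h').2, Sym2.congr_right] at h1
      rw [← h1] at hff
      exact hne ((hf (x e') ⟨(hx e' he').1, h'⟩).2 (h1 ▸ (hx e he).2.1) (hx e' he').2.1 hff)

/-- Menger's theorem for edge cuts: if no set between `{a}` and `X` has a smaller cut than `X`,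
then `a` is linked to the cut of `X`. -/
theorem exists_isLinkage (ha : a ∈ X)
    (hmin : ∀ Y ⊆ X, a ∈ Y → (cut s t F X).card ≤ (cut s t F Y).card) :
    ∃ P, IsLinkage s t F X a P := by
  induction hn : (inside s t F X).card using Nat.strong_induction_on generalizing s t F X with
  | _ n ih =>
  subst hn
  by_cases hdel : ∃ e ∈ inside s t F X, ∀ Y ⊆ X, a ∈ Y →
      (cut s t F X).card ≤ (cut s t (F.erase e) Y).card
  · obtain ⟨e, he, hY⟩ := hdel
    have hcut : cut s t (F.erase e) X = cut s t F X := by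
      rw [cut_erase, Finset.erase_eq_of_notMem]
      intro h
      have := mem_inside.1 he
      exact (mem_cut.1 h).2 (iff_of_true this.2.1 this.2.2)
    have hins : inside s t (F.erase e) X ⊆ (inside s t F X).erase e := fun f hf => by
      simp only [mem_inside, Finset.mem_erase] at hf ⊢; tauto
    obtain ⟨P, hP⟩ := ih _ (Finset.card_lt_card
      (hins.trans_ssubset (Finset.erase_ssubset he))) ha (by rwa [hcut]) rfl
    refine ⟨P, ?_, ?_, ?_⟩
    · exact fun f hf => ((hP.subset f (hcut ▸ hf)).trans hins).trans (Finset.erase_subset _ _)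
    · exact fun f hf => hP.joined f (hcut ▸ hf)
    · exact fun f hf f' hf' => hP.disjoint f (hcut ▸ hf) f' (hcut ▸ hf')
  push Not at hdel
  have htight : ∀ e ∈ inside s t F X, ∃ Y ⊆ X, a ∈ Y ∧ e ∈ cut s t F Y ∧
      (cut s t F Y).card = (cut s t F X).card := fun e he => by
    obtain ⟨Y, hYX, haY, hlt⟩ := hdel e he
    have h1 := hmin Y hYX haY
    have h2 := card_cut_le_card_cut_erase_add_one (s := s) (t := t) (F := F) (X := Y) (e := e)
    exact ⟨Y, hYX, haY, mem_cut_of_card_cut_erase_lt (by omega), by omega⟩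
  by_cases hcon : ∃ e ∈ inside s t F X, ∃ Y ⊆ X, a ∈ Y ∧ e ∈ cut s t F Y ∧
      (cut s t F Y).card = (cut s t F X).card ∧ (inside s t F Y).Nonempty
  · obtain ⟨e, he, Y, hYX, haY, heY, hcard, hne⟩ := hcon
    have hins : inside s t F Y ⊆ inside s t F X := fun f hf => by
      rw [mem_inside] at hf ⊢
      exact ⟨hf.1, hYX hf.2.1, hYX hf.2.2⟩
    have hlt : (inside s t F Y).card < (inside s t F X).card := by
      refine Finset.card_lt_card (Finset.ssubset_iff_subset_ne.2 ⟨hins, fun h => ?_⟩)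
      have := mem_inside.1 (h ▸ he)
      exact (mem_cut.1 heY).2 (iff_of_true this.2.1 this.2.2)
    obtain ⟨P, hP⟩ := ih _ hlt haY (fun Z hZ haZ => hcard ▸ hmin Z (hZ.trans hYX) haZ) rfl
    have hlt' : (inside (fun e => collapse Y a (s e)) (fun e => collapse Y a (t e))
        (F \ inside s t F Y) X).card < (inside s t F X).card := by
      have hsub : inside (fun e => collapse Y a (s e)) (fun e => collapse Y a (t e))
          (F \ inside s t F Y) X ⊆ inside s t F X \ inside s t F Y := fun f hf => ?_
      · exact (Finset.card_le_card hsub).trans_lt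
          (Finset.card_lt_card (Finset.sdiff_ssubset hins hne))
      simp only [mem_inside, Finset.mem_sdiff, collapse_mem_iff hYX ha] at hf ⊢
      tauto
    obtain ⟨Q, hQ⟩ := ih _ hlt' ha (fun Z hZ haZ => by
      rw [cut_collapse, cut_collapse]
      simp only [collapse_mem_iff hYX ha, Set.ofPred_mem_eq]
      refine hmin _ (fun v hv => ?_) ?_
      · exact (collapse_mem_iff hYX ha).1 (hZ hv)
      · rw [Set.mem_ofPred_eq, collapse_of_mem haY]; exact haZ) rfl
    exact ⟨_, hP.comp hYX haY hQ⟩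
  · refine exists_isLinkage_of_star ha hmin fun e he => ?_
    obtain ⟨Y, hYX, haY, heY, hcard⟩ := htight e he
    have hempty : ∀ f, f ∉ inside s t F Y := fun f hf =>
      hcon ⟨e, he, Y, hYX, haY, heY, hcard, f, hf⟩
    by_contra! hea
    -- otherwise `{a}` has a smaller cut than `Y`
    have hss : cut s t F {a} ⊂ cut s t F Y := by
      refine (Finset.ssubset_iff_of_subset fun f hf => ?_).2 ⟨e, heY, fun h => ?_⟩
      · have := hempty f
        simp only [mem_inside, mem_cut, Set.mem_singleton_iff] at this hf ⊢
        grind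
      · simp only [mem_cut, Set.mem_singleton_iff] at h
        tauto
    have := Finset.card_lt_card hss
    have := hmin {a} (by simpa using ha) rfl
    omega

end Multigraph

/-! ### Packing connectors of three terminals -/

namespace Multigraph

open scoped Classical

variable {V E : Type*} {s t : E → V} {F J K : Finset E} {X Y : Set V} {a u v w : V} {e : E}
  {τ : Fin 3 → V}

lemma eq_or_eq_add_of_fin_three : ∀ i j : Fin 3, i = j ∨ i = j + 1 ∨ i = j + 2 := by decide

/-- The edges of `F` between `u` and `v`. -/
noncomputable def between (s t : E → V) (F : Finset E) (u v : V) : Finset E :=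
  F.filter fun e => s(s e, t e) = s(u, v)

lemma mem_between : e ∈ between s t F u v ↔ e ∈ F ∧ s(s e, t e) = s(u, v) := by simp [between]

lemma between_sdiff : between s t (F \ J) u v = between s t F u v \ between s t J u v := by
  ext e; simp only [mem_between, Finset.mem_sdiff]; tauto

lemma cut_union : cut s t (F ∪ J) X = cut s t F X ∪ cut s t J X := Finset.filter_union _ _ _

/-- The two kinds of pieces into which the edges are partitioned: kind `none` joins all three
terminals (a tripod), kind `some i` joins the two terminals other than `τ i` (a path). -/
def Links (s t : E → V) (τ : Fin 3 → V) : Option (Fin 3) → Finset E → Prop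
  | none, J => ∀ i j, Joined s t J (τ i) (τ j)
  | some i, J => Joined s t J (τ (i + 1)) (τ (i + 2))

/-- `F` contains disjoint pieces, `n k` of them of kind `k`. The family `J` is indexed by all of
`ℕ` for each kind, but only its first `n k` members are required to be of kind `k`. -/
def HasPieces (s t : E → V) (τ : Fin 3 → V) (F : Finset E) (n : Option (Fin 3) → ℕ) : Prop :=
  ∃ J : Option (Fin 3) × ℕ → Finset E, (∀ x, J x ⊆ F) ∧ Pairwise (Function.onFun Disjoint J) ∧
    ∀ k i, i < n k → Links s t τ k (J (k, i))

lemma HasPieces.insert {n : Option (Fin 3) → ℕ} (hJF : J ⊆ F) (k : Option (Fin 3))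
    (hJ : Links s t τ k J) (h : HasPieces s t τ (F \ J) n) :
    HasPieces s t τ F (Function.update n k (n k + 1)) := by
  obtain ⟨A, hAF, hA, hAn⟩ := h
  have hAJ : ∀ x, Disjoint J (A x) := fun x =>
    (Finset.disjoint_of_subset_left (hAF x) Finset.sdiff_disjoint).symm
  refine ⟨Function.update A (k, n k) J, fun x => ?_, fun x y hxy => ?_, fun l i hi => ?_⟩
  · by_cases hx : x = (k, n k)
    · subst hx; simpa using hJF
    · rw [Function.update_of_ne hx]; exact (hAF x).trans Finset.sdiff_subset
  · unfold Function.onFun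
    by_cases hx : x = (k, n k)
    · rw [hx, Function.update_self, Function.update_of_ne (hx ▸ hxy.symm)]
      exact hAJ y
    · by_cases hy : y = (k, n k)
      · rw [hy, Function.update_self, Function.update_of_ne hx]
        exact (hAJ x).symm
      · rw [Function.update_of_ne hx, Function.update_of_ne hy]
        exact hA hxy
  · by_cases hl : l = k
    · subst hl
      rw [Function.update_self] at hi
      by_cases hi' : i = n l
      · subst hi'; simpa using hJ
      · rw [Function.update_of_ne (by simpa using hi')]
        exact hAn l i (by omega)
    · rw [Function.update_of_ne hl] at hi
      rw [Function.update_of_ne (by simp [hl])]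
      exact hAn l i hi

/-- `F` contains pieces that together use the whole degree of each terminal. -/
def Decomposes (s t : E → V) (τ : Fin 3 → V) (F : Finset E) : Prop :=
  ∃ n, HasPieces s t τ F n ∧
    ∀ i, (cut s t F {τ i}).card ≤ n none + n (some (i + 1)) + n (some (i + 2))

lemma Decomposes.of_sdiff (hJF : J ⊆ F) (k : Option (Fin 3)) (hJ : Links s t τ k J)
    (hcard : ∀ i, (cut s t J {τ i}).card ≤ if k = some i then 0 else 1)
    (h : Decomposes s t τ (F \ J)) : Decomposes s t τ F := by
  obtain ⟨n, hn, hle⟩ := h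
  refine ⟨_, hn.insert hJF k hJ, fun i => ?_⟩
  have h1 : (cut s t F {τ i}).card ≤ (cut s t (F \ J) {τ i}).card + (cut s t J {τ i}).card := by
    conv_lhs => rw [← Finset.sdiff_union_of_subset hJF, cut_union]
    exact Finset.card_union_le _ _
  have h2 := hle i
  have h3 := hcard i
  rcases k with _ | k
  · simp only [Function.update_self, ne_eq, reduceCtorEq, not_false_eq_true, Function.update_of_ne,
      if_false] at h3 ⊢
    omega
  · fin_cases i <;> fin_cases k <;> simp [-Finset.card_eq_zero] at h1 h2 h3 ⊢ <;> omega

lemma sym2_eq_terminals (hτ : Function.Injective τ) {i j : Fin 3} (hv : v ∉ Set.range τ)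
    (h : s(v, τ i) = s(w, τ j)) : v = w ∧ i = j := by
  rcases Sym2.eq_iff.1 h with ⟨h1, h2⟩ | ⟨h1, h2⟩
  · exact ⟨h1, hτ h2⟩
  · exact absurd ⟨j, h1.symm⟩ hv

/-- Edges from one vertex `v` to each of several terminals form a piece. -/
lemma Decomposes.of_sdiff_image (hτ : Function.Injective τ) (hv : v ∉ Set.range τ)
    {g : Fin 3 → E} {I : Finset (Fin 3)} (hg : ∀ i ∈ I, g i ∈ between s t F v (τ i))
    (hI : I = Finset.univ ∨ ∃ i : Fin 3, I = {i + 1, i + 2})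
    (h : Decomposes s t τ (F \ I.image g)) : Decomposes s t τ F := by
  have hsub : I.image g ⊆ F := Finset.image_subset_iff.2 fun i hi => (mem_between.1 (hg i hi)).1
  have hj : ∀ i ∈ I, Joined s t (I.image g) v (τ i) := fun i hi =>
    .of_mem_of_sym2_eq (Finset.mem_image_of_mem g hi) (mem_between.1 (hg i hi)).2
  have hcut : ∀ i, (cut s t (I.image g) {τ i}).card ≤ if i ∈ I then 1 else 0 := fun i => by
    have hc : ∀ e ∈ cut s t (I.image g) {τ i}, i ∈ I ∧ e = g i := fun e he => by
      obtain ⟨he, hcut⟩ := mem_cut.1 he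
      obtain ⟨j, hjI, rfl⟩ := Finset.mem_image.1 he
      have hends := Sym2.eq_iff.1 (mem_between.1 (hg j hjI)).2
      have hvi : v ≠ τ i := fun h => hv ⟨i, h.symm⟩
      have hji : τ j = τ i := by
        simp only [Set.mem_singleton_iff] at hcut
        grind
      rw [← hτ hji]
      exact ⟨hjI, rfl⟩
    split_ifs with hi
    · exact Finset.card_le_one.2 fun e he f hf => (hc e he).2.trans (hc f hf).2.symm
    · exact (Finset.card_eq_zero.2 (Finset.eq_empty_of_forall_notMem fun e he =>
        hi (hc e he).1)).le
  rcases hI with rfl | ⟨i, rfl⟩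
  · exact h.of_sdiff hsub none (fun i j => (hj i (by simp)).symm.trans (hj j (by simp)))
      (by simpa using hcut)
  · refine h.of_sdiff hsub (some i) ((hj (i + 1) (by simp)).symm.trans (hj (i + 2) (by simp)))
      fun j => (hcut j).trans ?_
    fin_cases i <;> fin_cases j <;> simp

lemma card_between_sdiff_image (hτ : Function.Injective τ) (hv : v ∉ Set.range τ)
    {g : Fin 3 → E} {I : Finset (Fin 3)} (hg : ∀ i ∈ I, g i ∈ between s t F v (τ i))
    (w : V) (j : Fin 3) :
    (between s t (F \ I.image g) w (τ j)).card =
      (between s t F w (τ j)).card - if v = w ∧ j ∈ I then 1 else 0 := by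
  have hb : between s t (I.image g) w (τ j) = if v = w ∧ j ∈ I then {g j} else ∅ := by
    ext e
    rw [mem_between, Finset.mem_image]
    constructor
    · rintro ⟨⟨i, hi, rfl⟩, he⟩
      obtain ⟨hvw, rfl⟩ := sym2_eq_terminals hτ hv ((mem_between.1 (hg i hi)).2.symm.trans he)
      simp [hvw, hi]
    · split_ifs with h
      · obtain ⟨rfl, hjI⟩ := h
        intro he
        rw [Finset.mem_singleton] at he
        subst he
        exact ⟨⟨j, hjI, rfl⟩, (mem_between.1 (hg j hjI)).2⟩
      · simp
  rw [between_sdiff, Finset.card_sdiff_of_subset, hb]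
  · split_ifs <;> simp
  · exact Finset.filter_subset_filter _
      (Finset.image_subset_iff.2 fun i hi => (mem_between.1 (hg i hi)).1)

/-- If every edge is incident to a terminal, and at each other vertex the numbers of edges to the
three terminals satisfy the triangle inequalities, then the edges decompose into paths of length at
most two between terminals and at most one tripod at each vertex. -/
lemma decomposes_of_star (hτ : Function.Injective τ) (hne : ∀ e ∈ F, s e ≠ t e)
    (hinc : ∀ e ∈ F, s e ∈ Set.range τ ∨ t e ∈ Set.range τ)
    (htri : ∀ v ∉ Set.range τ, ∀ i, (between s t F v (τ i)).card ≤
      (between s t F v (τ (i + 1))).card + (between s t F v (τ (i + 2))).card) :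
    Decomposes s t τ F := by
  induction hn : F.card using Nat.strong_induction_on generalizing F with
  | _ n ih =>
  subst hn
  rcases F.eq_empty_or_nonempty with rfl | ⟨e, he⟩
  · exact ⟨0, ⟨fun _ => ∅, by simp, fun _ _ _ => by simp [Function.onFun], by simp⟩,
      by simp [cut]⟩
  -- removing edges keeps the first two hypotheses
  have step : ∀ J ⊆ F, J.Nonempty → (∀ v ∉ Set.range τ, ∀ i,
      (between s t (F \ J) v (τ i)).card ≤ (between s t (F \ J) v (τ (i + 1))).card +
        (between s t (F \ J) v (τ (i + 2))).card) → Decomposes s t τ (F \ J) :=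
    fun J hJ hJne h => ih _ (Finset.card_lt_card (Finset.sdiff_ssubset hJ hJne))
      (fun e he => hne e (Finset.mem_sdiff.1 he).1)
      (fun e he => hinc e (Finset.mem_sdiff.1 he).1) h rfl
  by_cases hboth : s e ∈ Set.range τ ∧ t e ∈ Set.range τ
  · obtain ⟨⟨i, hi⟩, ⟨j, hj⟩⟩ := hboth
    have hij : i ≠ j := fun h => hne e he (by rw [← hi, ← hj, h])
    obtain ⟨l, hl⟩ : ∃ l : Fin 3, s(i, j) = s(l + 1, l + 2) := by
      have : ∀ i j : Fin 3, i ≠ j → ∃ l : Fin 3, s(i, j) = s(l + 1, l + 2) := by decide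
      exact this i j hij
    have hends : s(s e, t e) = s(τ (l + 1), τ (l + 2)) := by
      rw [← hi, ← hj]; exact congrArg (Sym2.map τ) hl
    refine Decomposes.of_sdiff (J := {e}) (by simpa using he) (some l)
      (.of_mem_of_sym2_eq (Finset.mem_singleton_self e) hends) (fun m => ?_)
      (step _ (by simpa using he) (by simp) fun v hv m => ?_)
    · split_ifs with h
      · obtain rfl : l = m := by simpa using h
        have h1 : τ (l + 1) ≠ τ l := hτ.ne (by simp)
        have h2 : τ (l + 2) ≠ τ l := hτ.ne (by simp)
        rw [Nat.le_zero, Finset.card_eq_zero]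
        refine Finset.eq_empty_of_forall_notMem fun f hf => ?_
        obtain ⟨hf, hcut⟩ := mem_cut.1 hf
        rw [Finset.mem_singleton] at hf
        subst hf
        simp only [Set.mem_singleton_iff] at hcut
        rcases Sym2.eq_iff.1 hends with ⟨h3, h4⟩ | ⟨h3, h4⟩ <;> simp [h3, h4, h1, h2] at hcut
      · exact (Finset.card_filter_le _ _).trans (by simp)
    · have h0 : ∀ i, between s t {e} v (τ i) = ∅ := fun i =>
        Finset.eq_empty_of_forall_notMem fun f hf => by
          obtain ⟨hf, hb⟩ := mem_between.1 hf
          rw [Finset.mem_singleton] at hf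
          subst hf
          rcases Sym2.eq_iff.1 hb with ⟨h, -⟩ | ⟨-, h⟩
          · exact hv ⟨_, hi.trans h⟩
          · exact hv ⟨_, hj.trans h⟩
      simp only [between_sdiff, h0, Finset.sdiff_empty]
      exact htri v hv m
  · obtain ⟨v, hv, i, hvi⟩ : ∃ v ∉ Set.range τ, ∃ i, e ∈ between s t F v (τ i) := by
      rcases hinc e he with ⟨i, hi⟩ | ⟨i, hi⟩
      · exact ⟨t e, fun h => hboth ⟨⟨i, hi⟩, h⟩, i,
          mem_between.2 ⟨he, by rw [hi]; exact Sym2.eq_swap⟩⟩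
      · exact ⟨s e, fun h => hboth ⟨h, ⟨i, hi⟩⟩, i, mem_between.2 ⟨he, by rw [hi]⟩⟩
    have hpos : 0 < (between s t F v (τ i)).card := Finset.card_pos.2 ⟨e, hvi⟩
    -- at `v` there is a pair of edges to different terminals, or a whole tripod, whose removal
    -- preserves the triangle inequalities
    obtain ⟨I, hI, hIpos, hItri⟩ : ∃ I : Finset (Fin 3),
        (I = Finset.univ ∨ ∃ i : Fin 3, I = {i + 1, i + 2}) ∧
        (∀ i ∈ I, 0 < (between s t F v (τ i)).card) ∧
        ∀ i, (between s t F v (τ i)).card - (if i ∈ I then 1 else 0) ≤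
          (between s t F v (τ (i + 1))).card - (if i + 1 ∈ I then 1 else 0) +
          ((between s t F v (τ (i + 2))).card - (if i + 2 ∈ I then 1 else 0)) := by
      have h := htri v hv
      generalize hd : (fun i => (between s t F v (τ i)).card) = d at h hpos
      replace hd : ∀ i, (between s t F v (τ i)).card = d i := fun i => congrFun hd i
      simp only [hd] at h hpos ⊢
      have h0 : d 0 ≤ d 1 + d 2 := h 0
      have h1 : d 1 ≤ d 2 + d 0 := h 1
      have h2 : d 2 ≤ d 0 + d 1 := h 2
      have hp : 0 < d 0 ∨ 0 < d 1 ∨ 0 < d 2 := by fin_cases i <;> simp at hpos <;> tauto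
      have hcase : (0 < d 1 ∧ 0 < d 2 ∧ d 0 + 2 ≤ d 1 + d 2) ∨
          (0 < d 2 ∧ 0 < d 0 ∧ d 1 + 2 ≤ d 2 + d 0) ∨
          (0 < d 0 ∧ 0 < d 1 ∧ d 2 + 2 ≤ d 0 + d 1) ∨
          (d 0 = 1 ∧ d 1 = 1 ∧ d 2 = 1) := by omega
      rcases hcase with hc | hc | hc | hc
      · refine ⟨{1, 2}, Or.inr ⟨0, rfl⟩, by simp; omega, fun i => ?_⟩
        fin_cases i <;> simp <;> omega
      · refine ⟨{2, 0}, Or.inr ⟨1, rfl⟩, by simp; omega, fun i => ?_⟩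
        fin_cases i <;> simp <;> omega
      · refine ⟨{0, 1}, Or.inr ⟨2, rfl⟩, by simp; omega, fun i => ?_⟩
        fin_cases i <;> simp <;> omega
      · refine ⟨Finset.univ, Or.inl rfl, fun i _ => ?_, fun i => ?_⟩ <;>
        fin_cases i <;> simp <;> omega
    have hg : ∀ i, ∃ f, i ∈ I → f ∈ between s t F v (τ i) := fun i => by
      by_cases hi : i ∈ I
      · obtain ⟨f, hf⟩ := Finset.card_pos.1 (hIpos i hi)
        exact ⟨f, fun _ => hf⟩
      · exact ⟨e, fun h => absurd h hi⟩
    choose g hg using hg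
    refine Decomposes.of_sdiff_image hτ hv hg hI (step _ ?_ ?_ fun w hw j => ?_)
    · exact Finset.image_subset_iff.2 fun i hi => (mem_between.1 (hg i hi)).1
    · rw [Finset.image_nonempty]
      rcases hI with rfl | ⟨i, rfl⟩ <;> simp
    · simp only [card_between_sdiff_image hτ hv hg]
      by_cases hvw : v = w
      · subst hvw
        simpa using hItri j
      · simpa [hvw] using htri w hw j

/-- A family of `n` disjoint subsets of `F`, each of which connects the three terminals. -/
def HasConnectors (s t : E → V) (τ : Fin 3 → V) (F : Finset E) (n : ℕ) : Prop :=
  ∃ T : Fin n → Finset E, (∀ i, T i ⊆ F) ∧ Pairwise (Function.onFun Disjoint T) ∧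
    ∀ i u v, Joined s t (T i) (τ u) (τ v)

/-- Two paths of different kinds together connect the three terminals. -/
lemma Links.joined_of_pair {k : Fin 3} (h : Links s t τ (some (k + 1)) J)
    (h' : Links s t τ (some (k + 2)) K) (u v : Fin 3) : Joined s t (J ∪ K) (τ u) (τ v) := by
  have h1 : Joined s t (J ∪ K) (τ (k + 2)) (τ k) := by
    have := Joined.mono h (K := J ∪ K) Finset.subset_union_left
    rwa [show k + 1 + 1 = k + 2 by fin_cases k <;> rfl,
      show k + 1 + 2 = k by fin_cases k <;> rfl] at this
  have h2 : Joined s t (J ∪ K) (τ k) (τ (k + 1)) := by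
    have := Joined.mono h' (K := J ∪ K) Finset.subset_union_right
    rwa [show k + 2 + 1 = k by fin_cases k <;> rfl,
      show k + 2 + 2 = k + 1 by fin_cases k <;> rfl] at this
  have h3 : ∀ u, Joined s t (J ∪ K) (τ k) (τ u) := fun u => by
    obtain rfl | rfl | rfl : u = k ∨ u = k + 1 ∨ u = k + 2 := eq_or_eq_add_of_fin_three u k
    · exact .refl
    · exact h2
    · exact h1.symm
  exact (h3 u).symm.trans (h3 v)

/-- Each tripod is a connector; the paths are grouped into pairs of different kinds, and
if each terminal meets at least `k` pieces, this can be done so that `3 * k ≤ 4 * n + 2` holds for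
the total number `n` of connectors. -/
lemma HasPieces.hasConnectors {m : Option (Fin 3) → ℕ} (h : HasPieces s t τ F m) {k : ℕ}
    (hk : ∀ i : Fin 3, k ≤ m none + m (some (i + 1)) + m (some (i + 2))) :
    ∃ n, 3 * k ≤ 4 * n + 2 ∧ HasConnectors s t τ F n := by
  obtain ⟨J, hJF, hJ, hL⟩ := h
  -- `α i` pairs consist of a path of kind `i + 1` and one of kind `i + 2`
  obtain ⟨α₀, α₁, α₂, h0, h1, h2, hn⟩ : ∃ α₀ α₁ α₂ : ℕ, α₁ + α₂ ≤ m (some 0) ∧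
      α₂ + α₀ ≤ m (some 1) ∧ α₀ + α₁ ≤ m (some 2) ∧
      3 * k ≤ 4 * (m none + α₀ + α₁ + α₂) + 2 := by
    have h0 : k ≤ m none + m (some 1) + m (some 2) := hk 0
    have h1 : k ≤ m none + m (some 2) + m (some 0) := hk 1
    have h2 : k ≤ m none + m (some 0) + m (some 1) := hk 2
    generalize m none = w at *
    generalize m (some 0) = x at *
    generalize m (some 1) = y at *
    generalize m (some 2) = z at *
    by_cases hx : y + z ≤ x
    · exact ⟨0, z, y, by omega, by omega, by omega, by omega⟩
    by_cases hy : z + x ≤ y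
    · exact ⟨z, 0, x, by omega, by omega, by omega, by omega⟩
    by_cases hz : x + y ≤ z
    · exact ⟨y, x, 0, by omega, by omega, by omega, by omega⟩
    · exact ⟨(y + z - x + 1) / 2, (z + x - y) / 2, (x + y - z) / 2,
        by omega, by omega, by omega, by omega⟩
  let g : ℕ → Finset (Option (Fin 3) × ℕ) := fun i =>
    if i < m none then {(none, i)}
    else if i < m none + α₀ then {(some 1, i - m none), (some 2, i - m none)}
    else if i < m none + α₀ + α₁ then {(some 2, i - m none), (some 0, i - m none - α₀)}
    else {(some 0, i - m none - α₀), (some 1, i - m none - α₁)}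
  have hg : ∀ i j, i ≠ j → Disjoint (g i) (g j) := fun i j hij => by
    simp only [g]
    split_ifs <;> simp <;> omega
  refine ⟨_, hn, fun i => (g i).biUnion J, fun i => Finset.biUnion_subset.2 fun x _ => hJF x,
    fun i j hij => ?_, fun i u v => ?_⟩
  · unfold Function.onFun
    rw [Finset.disjoint_biUnion_left]
    intro x hx
    rw [Finset.disjoint_biUnion_right]
    intro y hy
    refine hJ fun hxy => ?_
    exact Finset.disjoint_left.1 (hg i j (Fin.val_ne_of_ne hij)) hx (hxy ▸ hy)
  · have hi := i.2
    simp only [g]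
    split_ifs with c1 c2 c3
    · rw [Finset.singleton_biUnion]
      exact hL none i c1 u v
    · rw [Finset.biUnion_insert, Finset.singleton_biUnion]
      exact Links.joined_of_pair (k := 0) (hL (some 1) _ (by omega)) (hL (some 2) _ (by omega)) u v
    · rw [Finset.biUnion_insert, Finset.singleton_biUnion]
      exact Links.joined_of_pair (k := 1) (hL (some 2) _ (by omega)) (hL (some 0) _ (by omega)) u v
    · rw [Finset.biUnion_insert, Finset.singleton_biUnion]
      exact Links.joined_of_pair (k := 2) (hL (some 0) _ (by omega)) (hL (some 1) _ (by omega)) u v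

/-- If every cut separating one terminal from the other two has at least `k` edges, and each edge
lies in such a cut of exactly `k` edges all of which are incident to the separated terminal, then
the edges decompose into paths and tripods. -/
lemma decomposes_of_tight (hτ : Function.Injective τ) {k : ℕ}
    (hcut : ∀ X i, (∀ j, τ j ∈ X ↔ j = i) → k ≤ (cut s t F X).card)
    (htight : ∀ e ∈ F, ∃ i, e ∈ cut s t F {τ i} ∧ (cut s t F {τ i}).card = k) :
    Decomposes s t τ F := by
  have hinc : ∀ e ∈ F, s e ∈ Set.range τ ∨ t e ∈ Set.range τ := fun e he => by
    obtain ⟨i, hi, -⟩ := htight e he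
    have := (mem_cut.1 hi).2
    simp only [Set.mem_singleton_iff] at this
    by_cases h : s e = τ i
    · exact Or.inl ⟨i, h.symm⟩
    · exact Or.inr ⟨i, by tauto⟩
  refine decomposes_of_star hτ (fun e he h => ?_) hinc fun v hv i => ?_
  · obtain ⟨i, hi, -⟩ := htight e he
    exact (mem_cut.1 hi).2 (by rw [h])
  · by_cases hem : between s t F v (τ i) = ∅
    · simp [hem]
    obtain ⟨e, heb⟩ := Finset.nonempty_iff_ne_empty.2 hem
    obtain ⟨he, hends⟩ := mem_between.1 heb
    have hvτ : ∀ j, τ j ≠ v := fun j h => hv ⟨j, h⟩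
    -- `τ i` has degree exactly `k`, so the cut of `{τ i, v}` is not smaller
    have hk : (cut s t F {τ i}).card = k := by
      obtain ⟨j, hj, hjk⟩ := htight e he
      have := (mem_cut.1 hj).2
      simp only [Set.mem_singleton_iff] at this
      have hji : τ j = τ i := by
        have := hvτ j
        have := Sym2.eq_iff.1 hends
        grind
      rwa [hji] at hjk
    have h1 := hcut {τ i, v} i fun j => by
      simp only [Set.mem_insert_iff, Set.mem_singleton_iff, hvτ j, or_false]
      exact hτ.eq_iff
    have hsub : between s t F v (τ i) ⊆ cut s t F {τ i} := fun f hf => by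
      obtain ⟨hf, hb⟩ := mem_between.1 hf
      refine mem_cut.2 ⟨hf, ?_⟩
      have := hvτ i
      simp only [Set.mem_singleton_iff]
      rcases Sym2.eq_iff.1 hb with ⟨h, h'⟩ | ⟨h, h'⟩ <;> rw [h, h'] <;> tauto
    have h2 : cut s t F {τ i, v} ⊆ (cut s t F {τ i} \ between s t F v (τ i)) ∪
        (between s t F v (τ (i + 1)) ∪ between s t F v (τ (i + 2))) := fun f hf => by
      obtain ⟨hf, hc⟩ := mem_cut.1 hf
      have hr : ∀ x ∈ Set.range τ, x = τ i ∨ x = τ (i + 1) ∨ x = τ (i + 2) := by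
        rintro _ ⟨j, rfl⟩
        rcases eq_or_eq_add_of_fin_three j i with rfl | rfl | rfl <;> simp
      have h1 := hr (s f)
      have h2 := hr (t f)
      have h3 := hinc f hf
      have h4 : ∀ x ∈ Set.range τ, x ≠ v := fun x hx h => hv (h ▸ hx)
      have h5 := h4 (s f)
      have h6 := h4 (t f)
      simp only [Set.mem_insert_iff, Set.mem_singleton_iff] at hc
      simp only [mem_cut, mem_between, Finset.mem_union, Finset.mem_sdiff, Set.mem_singleton_iff,
        Sym2.eq_iff]
      grind
    have h3 := (Finset.card_le_card h2).trans (Finset.card_union_le _ _)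
    have h4 := Finset.card_union_le (between s t F v (τ (i + 1))) (between s t F v (τ (i + 2)))
    rw [Finset.card_sdiff_of_subset hsub] at h3
    have h5 := Finset.card_le_card hsub
    omega

/-- Kriesell's theorem for three terminals: if every cut separating one terminal from the other two
has at least `k` edges, then there are `n` disjoint connectors with `3 * k ≤ 4 * n + 2`. -/
theorem exists_hasConnectors (hτ : Function.Injective τ) {k : ℕ}
    (hcut : ∀ X i, (∀ j, τ j ∈ X ↔ j = i) → k ≤ (cut s t F X).card) :
    ∃ n, 3 * k ≤ 4 * n + 2 ∧ HasConnectors s t τ F n := by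
  induction hn : F.card using Nat.strong_induction_on generalizing s t F with
  | _ n ih =>
  subst hn
  by_cases hdel : ∃ e ∈ F, ∀ X i, (∀ j, τ j ∈ X ↔ j = i) → k ≤ (cut s t (F.erase e) X).card
  · obtain ⟨e, he, h⟩ := hdel
    obtain ⟨n, hn, T, hTF, hT⟩ := ih _ (Finset.card_erase_lt_of_mem he) h rfl
    exact ⟨n, hn, T, fun i => (hTF i).trans (Finset.erase_subset _ _), hT⟩
  push Not at hdel
  have htight : ∀ e ∈ F, ∃ X i, (∀ j, τ j ∈ X ↔ j = i) ∧ e ∈ cut s t F X ∧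
      (cut s t F X).card = k := fun e he => by
    obtain ⟨X, i, hXi, hlt⟩ := hdel e he
    have h1 := hcut X i hXi
    have h2 := card_cut_le_card_cut_erase_add_one (s := s) (t := t) (F := F) (X := X) (e := e)
    exact ⟨X, i, hXi, mem_cut_of_card_cut_erase_lt (by omega), by omega⟩
  by_cases hcon : ∃ X i, (∀ j, τ j ∈ X ↔ j = i) ∧ (cut s t F X).card = k ∧
      (inside s t F X).Nonempty
  · -- contract the side `X` of a minimum cut, and prolong the connectors inside `X`
    obtain ⟨X, i, hXi, hXk, hne⟩ := hcon
    have hiX : τ i ∈ X := (hXi i).2 rfl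
    obtain ⟨P, hP⟩ := exists_isLinkage (s := s) (t := t) (F := F) hiX fun Y hY hiY =>
      hXk ▸ hcut Y i fun j => ⟨fun h => (hXi j).1 (hY h), fun h => h ▸ hiY⟩
    have hfix : ∀ j, collapse X (τ i) (τ j) = τ j := fun j => by
      by_cases hj : τ j ∈ X
      · rw [collapse_of_mem hj, (hXi j).1 hj]
      · exact collapse_of_notMem hj
    obtain ⟨n, hn, T, hTF, hT, hTj⟩ := ih (F \ inside s t F X).card
      (Finset.card_lt_card (Finset.sdiff_ssubset (Finset.filter_subset _ _) hne))
      (s := fun e => collapse X (τ i) (s e)) (t := fun e => collapse X (τ i) (t e))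
      (fun Z l hZ => by
        rw [cut_collapse]
        refine hcut _ l fun j => ?_
        rw [Set.mem_ofPred_eq, hfix]
        exact hZ j) rfl
    have hdis : ∀ l, Disjoint (T l) (inside s t F X) := fun l =>
      Finset.disjoint_of_subset_left (hTF l) Finset.sdiff_disjoint
    refine ⟨n, hn, fun l => T l ∪ continuation s t F X P (T l), fun l => ?_, fun l l' hne => ?_,
      fun l u v => ?_⟩
    · exact Finset.union_subset ((hTF l).trans Finset.sdiff_subset)
        (hP.continuation_subset.trans (Finset.filter_subset _ _))
    · exact hP.disjoint_union_continuation (hdis l) (hdis l') (hT hne)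
    · refine hP.joined_union (hTF l) le_rfl ?_ ?_ ?_
      · rw [hfix, hfix]
        exact hTj l u v
      · intro h
        rw [(hXi u).1 h]
        exact .refl
      · intro h
        rw [(hXi v).1 h]
        exact .refl
  · have hstar : ∀ e ∈ F, ∃ i, e ∈ cut s t F {τ i} ∧ (cut s t F {τ i}).card = k := fun e he => by
      obtain ⟨X, i, hXi, heX, hXk⟩ := htight e he
      have hiX : τ i ∈ X := (hXi i).2 rfl
      have hempty : ∀ f, f ∉ inside s t F X := fun f hf => hcon ⟨X, i, hXi, hXk, f, hf⟩
      have hsub : cut s t F {τ i} ⊆ cut s t F X := fun f hf => by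
        have := hempty f
        simp only [mem_inside, mem_cut, Set.mem_singleton_iff] at this hf ⊢
        grind
      have hle := hcut {τ i} i fun j => hτ.eq_iff
      have heq := Finset.eq_of_subset_of_card_le hsub (hXk ▸ hle)
      exact ⟨i, heq ▸ heX, heq ▸ hXk⟩
    obtain ⟨m, hm, hle⟩ := decomposes_of_tight hτ hcut hstar
    exact hm.hasConnectors fun i => (hcut {τ i} i fun j => hτ.eq_iff).trans (hle i)

end Multigraph

/-! ### Steiner packings and cuts of simple graphs -/

namespace SimpleGraph

open scoped Classical

variable {V W : Type*} {G : SimpleGraph V}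

/-- The edges of `G` from `X` to its complement, as ordered pairs starting in `X`. -/
noncomputable def crossing [Fintype V] (G : SimpleGraph V) (X : Set V) : Finset (V × V) :=
  Finset.univ.filter fun p => G.Adj p.1 p.2 ∧ p.1 ∈ X ∧ p.2 ∉ X

lemma mem_crossing [Fintype V] {X : Set V} {p : V × V} :
    p ∈ G.crossing X ↔ G.Adj p.1 p.2 ∧ p.1 ∈ X ∧ p.2 ∉ X := by simp [crossing]

/-- Every Steiner tree has an edge leaving a set that separates two of its terminals. -/
lemma le_card_crossing [Fintype V] {S : Finset V} {X : Set V} (hX : ∃ u ∈ S, u ∈ X)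
    (hX' : ∃ v ∈ S, v ∉ X) {m : ℕ} {T : Fin m → G.Subgraph} (hT : ∀ i, G.IsSteinerTree S (T i))
    (hdis : ∀ i j, i ≠ j → Disjoint (T i).edgeSet (T j).edgeSet) :
    m ≤ (G.crossing X).card := by
  obtain ⟨u, huS, huX⟩ := hX
  obtain ⟨v, hvS, hvX⟩ := hX'
  have h : ∀ i, ∃ p : V × V, (T i).Adj p.1 p.2 ∧ p.1 ∈ X ∧ p.2 ∉ X := fun i => by
    obtain ⟨p⟩ := (hT i).1.connected.preconnected ⟨u, (hT i).2 huS⟩ ⟨v, (hT i).2 hvS⟩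
    obtain ⟨d, -, hd1, hd2⟩ := p.exists_boundary_dart {x | x.1 ∈ X} huX hvX
    exact ⟨(d.fst, d.snd), d.adj, hd1, hd2⟩
  choose p hp hpX hpX' using h
  have hinj : Function.Injective p := fun i j hij => by
    by_contra hne
    have hj : s((p i).1, (p i).2) ∈ (T j).edgeSet := hij ▸ hp j
    exact Set.disjoint_left.1 (hdis i j hne) (hp i) hj
  calc m = (Finset.univ : Finset (Fin m)).card := by simp
    _ ≤ _ := Finset.card_le_card_of_injOn p
      (fun i _ => mem_crossing.2 ⟨(hp i).adj_sub, hpX i, hpX' i⟩) hinj.injOn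

lemma steinerPacking_le_card_crossing [Fintype V] {S : Finset V} {X : Set V}
    (hX : ∃ u ∈ S, u ∈ X) (hX' : ∃ v ∈ S, v ∉ X) :
    G.steinerPacking S ≤ (G.crossing X).card := by
  refine csSup_le' ?_
  rintro m ⟨T, hT, hdis⟩
  exact le_card_crossing hX hX' hT hdis

/-- A connected edge set meeting all terminals contains a Steiner tree. -/
lemma exists_isSteinerTree {S : Finset V} {J : Finset (Sym2 V)} (hJ : ∀ e ∈ J, e ∈ G.edgeSet)
    {r : V} (hr : ∀ u ∈ S, (fromEdgeSet (J : Set (Sym2 V))).Reachable r u) :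
    ∃ T : G.Subgraph, G.IsSteinerTree S T ∧ T.edgeSet ⊆ J := by
  set C := (fromEdgeSet (J : Set (Sym2 V))).connectedComponentMk r
  obtain ⟨T, hT, htree⟩ := C.connected_toSimpleGraph.exists_isTree_le
  have hadj : ∀ {u v : C}, T.Adj u v → s(u.1, v.1) ∈ J := fun h =>
    ((fromEdgeSet_adj _).1 (hT h)).1
  let T' : G.Subgraph :=
    { verts := C.supp
      Adj := fun u v => ∃ (hu : u ∈ C.supp) (hv : v ∈ C.supp), T.Adj ⟨u, hu⟩ ⟨v, hv⟩
      adj_sub := fun ⟨_, _, h⟩ => hJ _ (hadj h)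
      edge_vert := fun ⟨hu, _⟩ => hu
      symm := ⟨fun _ _ ⟨hu, hv, h⟩ => ⟨hv, hu, h.symm⟩⟩ }
  have hcoe : T'.coe = T := by
    ext u v
    exact ⟨fun ⟨_, _, h⟩ => h, fun h => ⟨u.2, v.2, h⟩⟩
  refine ⟨T', ⟨hcoe ▸ htree, fun u hu => ?_⟩, ?_⟩
  · exact ConnectedComponent.sound (hr u hu).symm
  · intro e
    induction e with
    | _ u v => exact fun ⟨_, _, h⟩ => hadj h

/-- Disjoint connected edge sets meeting all terminals bound the Steiner packing number from
below. -/
lemma le_steinerPacking [Fintype V] {S : Finset V} (hS : 2 ≤ S.card) {m : ℕ}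
    {J : Fin m → Finset (Sym2 V)} (hJ : ∀ i, ∀ e ∈ J i, e ∈ G.edgeSet)
    (hdis : ∀ i j, i ≠ j → Disjoint (J i) (J j)) {r : Fin m → V}
    (hr : ∀ i, ∀ u ∈ S, (fromEdgeSet (J i : Set (Sym2 V))).Reachable (r i) u) :
    m ≤ G.steinerPacking S := by
  choose T hT hTJ using fun i => exists_isSteinerTree (hJ i) (hr i)
  obtain ⟨u, hu, v, hv, huv⟩ := Finset.one_lt_card.1 hS
  refine le_csSup ⟨(G.crossing ({u} : Set V)).card, ?_⟩ ⟨T, hT, fun i j hij => ?_⟩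
  · rintro m ⟨T, hT, hdis⟩
    exact le_card_crossing (X := {u}) ⟨u, hu, rfl⟩ ⟨v, hv, Ne.symm huv⟩ hT hdis
  · exact Set.disjoint_of_subset (hTJ i) (hTJ j) (Finset.disjoint_coe.2 (hdis i j hij))

lemma reachable_of_joined {J : Finset (Sym2 V)} {u v : V}
    (h : Multigraph.Joined (fun e : Sym2 V => e.out.1) (fun e => e.out.2) J u v) :
    (fromEdgeSet (J : Set (Sym2 V))).Reachable u v := by
  refine (h {x | (fromEdgeSet (J : Set (Sym2 V))).Reachable u x} fun e he => ?_).1 (.refl u)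
  have hR : (fromEdgeSet (J : Set (Sym2 V))).Reachable e.out.1 e.out.2 := by
    by_cases hne : e.out.1 = e.out.2
    · rw [hne]
    · refine Adj.reachable ((fromEdgeSet_adj _).2 ⟨?_, hne⟩)
      rwa [show s(e.out.1, e.out.2) = e from Quot.out_eq e]
  exact ⟨fun h => h.trans hR, fun h => h.trans hR.symm⟩

/-- Kriesell's theorem for three terminals, in terms of a minimum cut separating them. -/
theorem exists_crossing_le_steinerPacking [Fintype V] (G : SimpleGraph V) {S : Finset V}
    (hS : S.card = 3) : ∃ X : Set V, (∃ u ∈ S, u ∈ X) ∧ (∃ v ∈ S, v ∉ X) ∧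
      3 * (G.crossing X).card ≤ 4 * G.steinerPacking S + 2 := by
  obtain ⟨τ, hτ, hτS⟩ : ∃ τ : Fin 3 → V, Function.Injective τ ∧ ∀ u, u ∈ S ↔ ∃ i, τ i = u := by
    let φ := S.equivFinOfCardEq hS
    exact ⟨fun i => φ.symm i, fun i j h => φ.symm.injective (Subtype.ext h), fun u =>
      ⟨fun hu => ⟨φ ⟨u, hu⟩, by simp⟩, by rintro ⟨i, rfl⟩; exact (φ.symm i).2⟩⟩
  let s : Sym2 V → V := fun e => e.out.1
  let t : Sym2 V → V := fun e => e.out.2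
  have hst : ∀ e, s(s e, t e) = e := fun e => Quot.out_eq e
  let F : Finset (Sym2 V) := Finset.univ.filter (· ∈ G.edgeSet)
  let N : Set ℕ := {c | ∃ X i, (∀ j, τ j ∈ X ↔ j = i) ∧ (Multigraph.cut s t F X).card = c}
  have hN : N.Nonempty := ⟨_, {τ 0}, 0, fun j => hτ.eq_iff, rfl⟩
  obtain ⟨X, i, hXi, hXc⟩ := Nat.sInf_mem hN
  obtain ⟨n, hn, T, hTF, hdis, hT⟩ := Multigraph.exists_hasConnectors (s := s) (t := t) (F := F) hτ
    (k := sInf N) fun Y j hY => Nat.sInf_le ⟨Y, j, hY, rfl⟩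
  have hle : n ≤ G.steinerPacking S := by
    refine le_steinerPacking (by omega) (fun l e he => (Finset.mem_filter.1 (hTF l he)).2)
      (fun l l' h => hdis h) (r := fun _ => τ 0) fun l u hu => ?_
    obtain ⟨j, rfl⟩ := (hτS u).1 hu
    exact reachable_of_joined (hT l 0 j)
  have hcross : (G.crossing X).card ≤ (Multigraph.cut s t F X).card := by
    refine Finset.card_le_card_of_injOn (fun p => s(p.1, p.2)) (fun p hp => ?_) ?_
    · obtain ⟨hadj, h1, h2⟩ := mem_crossing.1 hp
      refine Multigraph.mem_cut.2 ⟨by simpa [F] using hadj, ?_⟩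
      rcases Sym2.eq_iff.1 (hst s(p.1, p.2)) with ⟨h, h'⟩ | ⟨h, h'⟩ <;> rw [h, h'] <;> tauto
    · intro p hp q hq hpq
      obtain ⟨-, hp1, hp2⟩ := mem_crossing.1 hp
      obtain ⟨-, hq1, hq2⟩ := mem_crossing.1 hq
      rcases Sym2.eq_iff.1 hpq with ⟨h, h'⟩ | ⟨h, h'⟩
      · exact Prod.ext h h'
      · exact absurd (h ▸ hp1) hq2
  refine ⟨X, ⟨τ i, (hτS _).2 ⟨i, rfl⟩, (hXi i).2 rfl⟩,
    ⟨τ (i + 1), (hτS _).2 ⟨_, rfl⟩, fun h => ?_⟩, by omega⟩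
  have := (hXi _).1 h
  simp at this

lemma genEdgeConn_three_le_card_crossing [Fintype V] (hV : 3 ≤ Fintype.card V) {X : Set V}
    (hX : X.Nonempty) (hX' : Xᶜ.Nonempty) : G.genEdgeConn 3 ≤ (G.crossing X).card := by
  obtain ⟨u, hu⟩ := hX
  obtain ⟨v, hv⟩ := hX'
  obtain ⟨S, hS, -, hcard⟩ := Finset.exists_subsuperset_card_eq
    (Finset.subset_univ ({u, v} : Finset V)) (Finset.card_le_two.trans (by norm_num : 2 ≤ 3)) hV
  have hmem : G.genEdgeConn 3 ≤ G.steinerPacking S := Nat.sInf_le ⟨S, hcard, rfl⟩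
  exact hmem.trans
    (steinerPacking_le_card_crossing ⟨u, hS (by simp), hu⟩ ⟨v, hS (by simp), hv⟩)

/-- Some cut of `G` bounds `λ₃(G)` from below as in Kriesell's theorem. -/
lemma exists_crossing_le_genEdgeConn [Fintype V] (G : SimpleGraph V) (hV : 3 ≤ Fintype.card V) :
    ∃ X : Set V, X.Nonempty ∧ Xᶜ.Nonempty ∧ 3 * (G.crossing X).card ≤ 4 * G.genEdgeConn 3 + 2 := by
  obtain ⟨S, -, hS⟩ := Finset.exists_subset_card_eq (s := (Finset.univ : Finset V)) hV
  obtain ⟨S, hS, hSm⟩ : ∃ S : Finset V, S.card = 3 ∧ G.steinerPacking S = G.genEdgeConn 3 :=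
    Nat.sInf_mem (s := {m | ∃ S : Finset V, S.card = 3 ∧ G.steinerPacking S = m}) ⟨_, S, hS, rfl⟩
  obtain ⟨X, ⟨u, -, hu⟩, ⟨v, -, hv⟩, hX⟩ := G.exists_crossing_le_steinerPacking hS
  exact ⟨X, ⟨u, hu⟩, ⟨v, hv⟩, hSm ▸ hX⟩

/-! ### The bounds for the lexicographic product -/

lemma card_crossing_lexProduct_le [Fintype V] [Fintype W] (G : SimpleGraph V) (H : SimpleGraph W)
    (X : Set V) : ((G.lexProduct H).crossing {p | p.1 ∈ X}).card ≤
      (G.crossing X).card * Fintype.card W ^ 2 := by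
  have h : Fintype.card W ^ 2 = (Finset.univ : Finset (W × W)).card := by
    rw [Finset.card_univ, Fintype.card_prod, sq]
  rw [h, ← Finset.card_product]
  refine Finset.card_le_card_of_injOn (fun p => ((p.1.1, p.2.1), (p.1.2, p.2.2))) ?_ ?_
  · intro p hp
    obtain ⟨hadj, h1, h2⟩ := mem_crossing.1 hp
    refine Finset.mem_coe.2 (Finset.mem_product.2 ⟨mem_crossing.2 ⟨?_, h1, h2⟩, Finset.mem_univ _⟩)
    rcases hadj with h | ⟨h, -⟩
    · exact h
    · exact absurd (show p.2.1 ∈ X from h ▸ h1) h2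
  · rintro ⟨⟨a, b⟩, c, d⟩ - ⟨⟨a', b'⟩, c', d'⟩ - h
    simp only [Prod.mk.injEq] at h ⊢
    tauto

lemma card_crossing_singleton_lexProduct_le [Fintype V] [Fintype W] (G : SimpleGraph V)
    (H : SimpleGraph W) [DecidableRel G.Adj] [DecidableRel H.Adj] (u : V) (w : W) :
    ((G.lexProduct H).crossing {(u, w)}).card ≤ H.degree w + G.degree u * Fintype.card W := by
  have hsub : ∀ p ∈ (G.lexProduct H).crossing {(u, w)}, p.1 = (u, w) ∧
      p.2 ∈ ({u} : Finset V) ×ˢ H.neighborFinset w ∪ G.neighborFinset u ×ˢ Finset.univ := by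
    rintro ⟨p, q⟩ hp
    obtain ⟨hadj, h1, -⟩ := mem_crossing.1 hp
    obtain rfl : p = (u, w) := h1
    refine ⟨rfl, ?_⟩
    rcases hadj with h | ⟨h, h'⟩
    · simp_all
    · simp_all
  refine (Finset.card_le_card_of_injOn Prod.snd (fun p hp => (hsub p hp).2) fun p hp q hq h =>
    Prod.ext ((hsub p hp).1.trans (hsub q hq).1.symm) h).trans ?_
  refine (Finset.card_union_le _ _).trans ?_
  simp [Finset.card_product]

theorem genEdgeConn_three_lexProduct_le_minDegree [Fintype V] [Fintype W] [Nontrivial V]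
    [Nontrivial W] (G : SimpleGraph V) (H : SimpleGraph W) [DecidableRel G.Adj]
    [DecidableRel H.Adj] :
    (G.lexProduct H).genEdgeConn 3 ≤ H.minDegree + G.minDegree * Fintype.card W := by
  obtain ⟨u, hu⟩ := G.exists_minimal_degree_vertex
  obtain ⟨w, hw⟩ := H.exists_minimal_degree_vertex
  obtain ⟨u', hu'⟩ := exists_ne u
  have hV := Fintype.one_lt_card (α := V)
  have hW := Fintype.one_lt_card (α := W)
  rw [hu, hw]
  refine (genEdgeConn_three_le_card_crossing ?_ (Set.singleton_nonempty (u, w))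
    ⟨(u', w), by simp [hu']⟩).trans (card_crossing_singleton_lexProduct_le G H u w)
  rw [Fintype.card_prod]
  nlinarith

theorem genEdgeConn_three_lexProduct_le [Fintype V] [Fintype W] [Nontrivial W]
    (G : SimpleGraph V) (H : SimpleGraph W) (hV : 3 ≤ Fintype.card V) :
    (G.lexProduct H).genEdgeConn 3 ≤ (4 * G.genEdgeConn 3 + 2) / 3 * Fintype.card W ^ 2 := by
  obtain ⟨X, ⟨u, hu⟩, ⟨v, hv⟩, hX⟩ := G.exists_crossing_le_genEdgeConn hV
  obtain ⟨w⟩ : Nonempty W := inferInstance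
  have hW := Fintype.card_pos (α := W)
  have h1 : (G.lexProduct H).genEdgeConn 3 ≤ ((G.lexProduct H).crossing {p | p.1 ∈ X}).card := by
    refine genEdgeConn_three_le_card_crossing ?_ ⟨(u, w), hu⟩ ⟨(v, w), hv⟩
    rw [Fintype.card_prod]
    nlinarith
  refine h1.trans ((card_crossing_lexProduct_le G H X).trans (Nat.mul_le_mul_right _ ?_))
  omega

/-! ### Sharpness for a star and an edgeless graph -/

/-- The edges of the Steiner tree through the centre `c` and the leaf `x` of the product of a star
with an edgeless graph: `c` is joined to `x` and to the terminals among the leaves, and `x` to the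
terminals among the centres. -/
noncomputable def starTree (S : Finset V) (L : Set V) (c x : V) : Finset (Sym2 V) :=
  (S.filter (· ∈ L)).image (fun q => s(c, q)) ∪ {s(c, x)} ∪
    (S.filter (· ∉ L)).image (fun q => s(x, q))

lemma mem_starTree {S : Finset V} {L : Set V} {c x : V} {e : Sym2 V} : e ∈ starTree S L c x ↔
    (∃ q ∈ S, q ∈ L ∧ s(c, q) = e) ∨ e = s(c, x) ∨ ∃ q ∈ S, q ∉ L ∧ s(x, q) = e := by
  simp only [starTree, Finset.mem_union, Finset.mem_image, Finset.mem_filter,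
    Finset.mem_singleton, and_assoc, or_assoc]

lemma reachable_starTree {S : Finset V} {L : Set V} {c x : V} (hc : c ∉ L) (hx : x ∈ L)
    {u : V} (hu : u ∈ S) :
    (fromEdgeSet (starTree S L c x : Set (Sym2 V))).Reachable c u := by
  by_cases huL : u ∈ L
  · exact Adj.reachable ((fromEdgeSet_adj _).2
      ⟨mem_starTree.2 (Or.inl ⟨u, hu, huL, rfl⟩), fun h : c = u => hc (h ▸ huL)⟩)
  · refine (Adj.reachable ((fromEdgeSet_adj _).2 ⟨mem_starTree.2 (Or.inr (Or.inl rfl)),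
      fun h : c = x => hc (h ▸ hx)⟩)).trans (Adj.reachable ((fromEdgeSet_adj _).2
      ⟨mem_starTree.2 (Or.inr (Or.inr ⟨u, hu, huL, rfl⟩)), fun h : x = u => huL (h ▸ hx)⟩))

lemma disjoint_starTree {S : Finset V} {L : Set V} {c x c' x' : V} (hc : c ∉ L) (hc' : c' ∉ L)
    (hx : x ∈ L) (hx' : x' ∈ L) (hxS : x ∉ S) (hxS' : x' ∉ S) (hcc : c ≠ c') (hxx : x ≠ x') :
    Disjoint (starTree S L c x) (starTree S L c' x') := by
  rw [Finset.disjoint_left]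
  intro e he he'
  rw [mem_starTree] at he he'
  rcases he with ⟨q, hq, hqL, rfl⟩ | rfl | ⟨q, hq, hqL, rfl⟩ <;>
  rcases he' with ⟨q', hq', hqL', h⟩ | h | ⟨q', hq', hqL', h⟩ <;>
  rcases Sym2.eq_iff.1 h with ⟨h1, h2⟩ | ⟨h1, h2⟩ <;> subst_vars <;> contradiction

/-- If the product has `m + 3` leaves or more, every centre can be given its own leaf outside the
three terminals, which yields `m` disjoint Steiner trees. -/
lemma le_genEdgeConn_star_lexProduct_bot {n m : ℕ} [NeZero n] (hn : 3 ≤ n) (hm : 3 ≤ m) :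
    m ≤ ((starGraph (0 : Fin n)).lexProduct (⊥ : SimpleGraph (Fin m))).genEdgeConn 3 := by
  have hcardV : 3 ≤ (Finset.univ : Finset (Fin n × Fin m)).card := by
    rw [Finset.card_univ, Fintype.card_prod, Fintype.card_fin, Fintype.card_fin]
    nlinarith
  obtain ⟨S₀, -, hS₀⟩ := Finset.exists_subset_card_eq hcardV
  refine le_csInf ⟨_, S₀, hS₀, rfl⟩ ?_
  rintro _ ⟨S, hS, rfl⟩
  let L : Set (Fin n × Fin m) := {p | p.1 ≠ 0}
  obtain ⟨x, hxL, hxS, hx⟩ : ∃ x : Fin m → Fin n × Fin m, (∀ i, x i ∈ L) ∧ (∀ i, x i ∉ S) ∧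
      Function.Injective x := by
    let A : Finset (Fin n × Fin m) := (({0}ᶜ : Finset (Fin n)) ×ˢ Finset.univ) \ S
    have hA : m ≤ A.card := by
      have h1 := Finset.le_card_sdiff S (({0}ᶜ : Finset (Fin n)) ×ˢ (Finset.univ : Finset (Fin m)))
      rw [Finset.card_product, Finset.card_compl, Finset.card_singleton, Finset.card_univ,
        Fintype.card_fin, Fintype.card_fin, hS] at h1
      have h2 : 2 * m ≤ (n - 1) * m := Nat.mul_le_mul_right _ (by omega)
      have h3 : A.card = ((({0}ᶜ : Finset (Fin n)) ×ˢ (Finset.univ : Finset (Fin m))) \ S).card :=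
        rfl
      omega
    obtain ⟨f⟩ : Nonempty (Fin m ↪ A) := Function.Embedding.nonempty_of_card_le (by simpa using hA)
    have hf : ∀ i, (f i : Fin n × Fin m) ∈ A := fun i => (f i).2
    simp only [A, Finset.mem_sdiff, Finset.mem_product, Finset.mem_compl,
      Finset.mem_singleton] at hf
    exact ⟨fun i => f i, fun i => (hf i).1.1, fun i => (hf i).2,
      fun i j h => f.injective (Subtype.ext h)⟩
  have hc : ∀ i : Fin m, ((0 : Fin n), i) ∉ L := fun i h => h rfl
  refine le_steinerPacking (by omega) (J := fun i => starTree S L (0, i) (x i)) (fun i e he => ?_)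
    (fun i j hij => ?_) (r := fun i => (0, i)) fun i u hu => reachable_starTree (hc i) (hxL i) hu
  · have hadj : ∀ p q : Fin n × Fin m, p ∉ L → q ∈ L →
        ((starGraph (0 : Fin n)).lexProduct (⊥ : SimpleGraph (Fin m))).Adj p q :=
        fun p q hp hq => by
      have hp : p.1 = 0 := not_not.1 hp
      exact Or.inl (starGraph_adj.2 ⟨fun h => hq (h ▸ hp), Or.inl hp⟩)
    rcases mem_starTree.1 he with ⟨q, -, hq, rfl⟩ | rfl | ⟨q, -, hq, rfl⟩
    · exact hadj _ _ (hc i) hq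
    · exact hadj _ _ (hc i) (hxL i)
    · exact (hadj _ _ hq (hxL i)).symm
  · exact disjoint_starTree (hc i) (hc j) (hxL i) (hxL j) (hxS i) (hxS j) (by simpa using hij)
      (hx.ne hij)

lemma minDegree_starGraph_le_one {n : ℕ} [NeZero n] (hn : 2 ≤ n) :
    (starGraph (0 : Fin n)).minDegree ≤ 1 := by
  refine (minDegree_le_degree _ (⟨1, by omega⟩ : Fin n)).trans (Finset.card_le_one.2 ?_)
  have h : ∀ a ∈ (starGraph (0 : Fin n)).neighborFinset ⟨1, by omega⟩, a = 0 := fun a ha => by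
    rw [mem_neighborFinset, starGraph_adj] at ha
    refine ha.2.resolve_left fun h => ?_
    have := congrArg Fin.val h
    simp at this
  exact fun a ha b hb => (h a ha).trans (h b hb).symm

/-- Both sides lie between the number `N + 3` of centres and the minimum degree of the product. -/
theorem genEdgeConn_star_lexProduct_bot_eq (N : ℕ) :
    ((starGraph (0 : Fin (N + 3))).lexProduct (⊥ : SimpleGraph (Fin (N + 3)))).genEdgeConn 3 =
      min ((4 * (starGraph (0 : Fin (N + 3))).genEdgeConn 3 + 2) / 3 * (N + 3) ^ 2)
        ((⊥ : SimpleGraph (Fin (N + 3))).minDegree +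
          (starGraph (0 : Fin (N + 3))).minDegree * (N + 3)) := by
  have h1 := genEdgeConn_three_lexProduct_le (starGraph (0 : Fin (N + 3)))
    (⊥ : SimpleGraph (Fin (N + 3))) (by simp)
  have h2 := genEdgeConn_three_lexProduct_le_minDegree (starGraph (0 : Fin (N + 3)))
    (⊥ : SimpleGraph (Fin (N + 3)))
  rw [Fintype.card_fin] at h1 h2
  have h3 := le_genEdgeConn_star_lexProduct_bot (n := N + 3) (m := N + 3) (by omega) (by omega)
  have h4 := minDegree_starGraph_le_one (n := N + 3) (by omega)
  have h5 : (⊥ : SimpleGraph (Fin (N + 3))).minDegree = 0 := by simp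
  refine le_antisymm (le_min h1 h2) ((min_le_right _ _).trans (le_trans ?_ h3))
  rw [h5]
  nlinarith

end SimpleGraph

theorem theorem2 :
    (∀ (V : Type*) (W : Type*) [Fintype V] [Fintype W] [Nontrivial V] [Nontrivial W]
        (G : SimpleGraph V) (H : SimpleGraph W) [DecidableRel G.Adj] [DecidableRel H.Adj],
        G.Connected →
          (3 ≤ Fintype.card V →
            (G.lexProduct H).genEdgeConn 3 ≤
              min ((4 * G.genEdgeConn 3 + 2) / 3 * Fintype.card W ^ 2)
                (H.minDegree + G.minDegree * Fintype.card W)) ∧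
          -- for two vertices `λ₃(G)` is undefined and only the second term makes sense
          (Fintype.card V = 2 →
            (G.lexProduct H).genEdgeConn 3 ≤ H.minDegree + G.minDegree * Fintype.card W)) ∧
    (∀ N : ℕ, ∃ n₁ n₂ : ℕ, N ≤ n₁ ∧ N ≤ n₂ ∧ 3 ≤ n₁ ∧ 2 ≤ n₂ ∧
        ∃ (G : SimpleGraph (Fin n₁)) (H : SimpleGraph (Fin n₂))
          (_ : DecidableRel G.Adj) (_ : DecidableRel H.Adj),
          G.Connected ∧
            (G.lexProduct H).genEdgeConn 3 =
              min ((4 * G.genEdgeConn 3 + 2) / 3 * n₂ ^ 2)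
                (H.minDegree + G.minDegree * n₂)) := by
  refine ⟨fun V W _ _ _ _ G H _ _ _ => ⟨fun hV => le_min
    (SimpleGraph.genEdgeConn_three_lexProduct_le G H hV)
    (SimpleGraph.genEdgeConn_three_lexProduct_le_minDegree G H),
    fun _ => SimpleGraph.genEdgeConn_three_lexProduct_le_minDegree G H⟩, fun N => ?_⟩
  refine ⟨N + 3, N + 3, by omega, by omega, by omega, by omega, SimpleGraph.starGraph 0, ⊥,
    inferInstance, inferInstance, (SimpleGraph.isTree_starGraph 0).connected,
    SimpleGraph.genEdgeConn_star_lexProduct_bot_eq N⟩
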